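/- Let $K$ be a field of characteristic $0$ and let $L$ be a finite-dimensional associative (not necessarily unital or commutative) $K$-algebra with basis $(H_\nu)$ and multiplication $H_\mu H_\nu=\sum_\sigma B_{\mu\nu}^\sigma H_\sigma$; let $(X^\nu)$ be the dual basis of $L^*$. Let $R$ be the unital associative algebra with basis $\hat E,\hat H_\nu,\hat X^\nu$, identity $\hat E$, and products $$\hat H_\mu\hat H_\nu=\sum_\sigma B_{\mu\nu}^\sigma\hat H_\sigma,\quad \hat X^\nu\hat H_\mu=\sum_\sigma B_{\mu\sigma}^\nu\hat X^\sigma,\quad \hat X^\mu\hat X^\nu=0,\quad \hat H_\mu\hat X^\nu=0,$$ and let $\mathfrak g=L\oplus L^*$ be the Lie algebra with brackets $[H_\mu,H_\nu]=\sum_\sigma(B_{\mu\nu}^\sigma-B_{\nu\mu}^\sigma)H_\sigma$, $[H_\mu,X^\nu]=-\sum_\sigma B_{\mu\sigma}^\nu X^\sigma$, $[X^\mu,X^\nu]=0$. In $U(\mathfrak g)$, let $U(L)$ be the subalgebra generated by the $H_\nu$ and $U_d(L^*)$ the span of the products of $d$ of the $X^\nu$. Let $T(R)=\prod_{n\ge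 0}R^{\otimes n}$, with componentwise product, with the deconcatenation coproduct $\Delta$ (given by the identifications $R^{\otimes(m+n)}\cong R^{\otimes m}\otimes R^{\otimes n}$), and with the projection to $R^{\otimes 0}=K$ as counit. The map $x\mapsto\bigl(\sum_{i=1}^n 1\otimes\cdots\otimes\hat x\otimes\cdots\otimes 1\bigr)_n$ (with $\hat x$ in place $i$), $x\in\mathfrak g$, extends to an algebra homomorphism $U(\mathfrak g)\to T(R)$. A twisting cocycle in the completed tensor square $\prod_{m,n}R^{\otimes m}\otimes R^{\otimes n}$ of $T(R)$ is an invertible element $\Phi=(\Phi^{m,n})$ with $\Phi^{0,n}=1$, $\Phi^{m,0}=1$ and $$(\Delta\otimes\mathrm{id})(\Phi)\,\Phi_{12}=(\mathrm{id}\otimes\Delta)(\Phi)\,\Phi_{23}.$$ Let $\Phi^{1,1}=\hat E\otimes\hat E-\sum_\nu\hat X^\nu\otimes\hat H_\nu$. Then there is exactly one twisting cocycle $\Phi$ such that $\Phi^{1,k}=\Phi^{1,1}_{12}\Phi^{1,1}_{13}\cdots\Phi^{1,1}_{1,k+1}$ for all $k\ge 0$ (the twisting cocycle obtained from $\Phi^{1,1}$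 by the modified Reshetikhin procedure). It lies in the completion $\prod_d U_d(L^*)\otimes U(L)$ of $U(L^*)\otimes U(L)$ and has the form $\exp\bigl(-\sum_\nu\tilde X^\nu\otimes H_\nu\bigr)$, where each $\tilde X^\nu\in\prod_{d\ge 1}U_d(L^*)$ is a formal power series without constant term in the commuting elements $X^\mu$. That is, there are such $\tilde X^\nu$ for which all homogeneous components of this exponential lie in $U_d(L^*)\otimes U(L)$, and, for all $m,n$, the images of these components in $R^{\otimes m}\otimes R^{\otimes n}$ are zero for almost all $d$ and have sum $\Phi^{m,n}$. -/

import Mathlib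

open scoped TensorProduct

noncomputable section

/-! ### The ring `R` -/

section Ring

variable (K L : Type*) [Field K] [NonUnitalRing L] [Module K L]

/-- The underlying space `L ⊕ L*` of the semidirect product of a ring `L` with its dual. -/
def SemidirectRing : Type _ := L × Module.Dual K L

namespace SemidirectRing

instance : AddCommGroup (SemidirectRing K L) := inferInstanceAs (AddCommGroup (L × Module.Dual K L))

instance : Module K (SemidirectRing K L) := inferInstanceAs (Module K (L × Module.Dual K L))

/-- The inclusion of `L`. -/
def ofH : L →ₗ[K] SemidirectRing K L := LinearMap.inl K L (Module.Dual K L)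

/-- The inclusion of `L*`. -/
def ofX : Module.Dual K L →ₗ[K] SemidirectRing K L := LinearMap.inr K L (Module.Dual K L)

variable {K L} in
lemma ext' {a b : SemidirectRing K L} (h₁ : a.1 = b.1) (h₂ : ∀ l, a.2 l = b.2 l) : a = b :=
  Prod.ext h₁ (LinearMap.ext h₂)

variable {K L} in
@[simp] lemma add_fst (a b : SemidirectRing K L) : (a + b).1 = a.1 + b.1 := rfl

variable {K L} in
@[simp] lemma add_snd (a b : SemidirectRing K L) : (a + b).2 = a.2 + b.2 := rfl

variable {K L} in
@[simp] lemma smul_fst (c : K) (a : SemidirectRing K L) : (c • a).1 = c • a.1 := rfl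

variable {K L} in
@[simp] lemma smul_snd (c : K) (a : SemidirectRing K L) : (c • a).2 = c • a.2 := rfl

variable {K L} in
@[simp] lemma zero_fst : (0 : SemidirectRing K L).1 = 0 := rfl

variable {K L} in
@[simp] lemma zero_snd : (0 : SemidirectRing K L).2 = 0 := rfl

variable [SMulCommClass K L L]

/-- The product `(h, ξ) (h', ξ') = (h h', ξ · h')`, where `(ξ · h') (l) = ξ (h' l)` is the right
action of `L` on `L*`; in particular `H X = 0` and `X X' = 0`. -/
instance : Mul (SemidirectRing K L) :=
  ⟨fun a b => (a.1 * b.1, a.2.comp (LinearMap.mulLeft K b.1))⟩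

variable {K L} in
@[simp] lemma mul_fst (a b : SemidirectRing K L) : (a * b).1 = a.1 * b.1 := rfl

variable {K L} in
@[simp] lemma mul_snd_apply (a b : SemidirectRing K L) (l : L) :
    (a * b).2 l = a.2 (b.1 * l) := rfl

variable [IsScalarTower K L L]

instance : NonUnitalRing (SemidirectRing K L) where
  left_distrib a b c := ext' (by simp [mul_add]) (fun l => by simp [add_mul])
  right_distrib a b c := ext' (by simp [add_mul]) (fun l => by simp)
  zero_mul a := ext' (by simp) (fun l => by simp)
  mul_zero a := ext' (by simp) (fun l => by simp)
  mul_assoc a b c := ext' (by simp [mul_assoc]) (fun l => by simp [mul_assoc])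

instance : IsScalarTower K (SemidirectRing K L) (SemidirectRing K L) :=
  ⟨fun c a b => ext' (by simp [smul_mul_assoc]) (fun l => by simp)⟩

instance : SMulCommClass K (SemidirectRing K L) (SemidirectRing K L) :=
  ⟨fun c a b => ext' (by simp [mul_smul_comm]) (fun l => by simp [smul_mul_assoc])⟩

/-- The Lie algebra `L ▷ L*`: the commutator bracket, so that `[H, H']` is the commutator of `L`,
`[H, ξ] = - ξ (H ·)` and `[ξ, ξ'] = 0`. -/
instance : LieRing (SemidirectRing K L) where
  bracket a b := a * b - b * a
  add_lie a b c := by simp only [add_mul, mul_add]; abel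
  lie_add a b c := by simp only [add_mul, mul_add]; abel
  lie_self a := by simp
  leibniz_lie a b c := by
    simp only [mul_sub, sub_mul, mul_assoc]; abel

variable {K L} in
lemma lie_def (a b : SemidirectRing K L) : ⁅a, b⁆ = a * b - b * a := rfl

instance : LieAlgebra K (SemidirectRing K L) where
  lie_smul c a b := by simp only [lie_def, mul_smul_comm, smul_mul_assoc, smul_sub]

end SemidirectRing

variable [IsScalarTower K L L] [SMulCommClass K L L]

/-- The ring `R`: the semidirect product of `L` and `L*` with an identity adjoined. -/
abbrev RingR : Type _ := Unitization K (SemidirectRing K L)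

/-- The universal enveloping algebra of the Lie algebra `L ▷ L*`. -/
abbrev EnvR : Type _ := UniversalEnvelopingAlgebra K (SemidirectRing K L)

end Ring

/-! ### The twisting equation in the tensor bialgebra `T(A)`

An element of `T(A)` is a family of elements of the tensor powers of `A`; an element `Φ` of the
(completed) tensor square of `T(A)` is a family `Φ m n` in `A^{⊗m} ⊗ A^{⊗n}`. The product is
componentwise, the coproduct is deconcatenation, the counit is the projection to `A^{⊗0}`. -/

section Twist

variable (K A : Type*) [Field K] [Ring A] [Algebra K A]

/-- The completed tensor square of `T(A)`. -/
abbrev TensorBialgebraSq : Type _ := ∀ m n : ℕ, (⨂[K]^m A) ⊗[K] (⨂[K]^n A)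

/-- The component `A^{⊗(m+n)} → A^{⊗m} ⊗ A^{⊗n}` of the coproduct of `T(A)`. -/
def deconcat (m n : ℕ) : (⨂[K]^(m + n) A) →ₗ[K] (⨂[K]^m A) ⊗[K] (⨂[K]^n A) :=
  (TensorPower.mulEquiv (R := K) (M := A) (n := m) (m := n)).symm.toLinearMap

variable {K A}

/-- `Φ` is invertible, normalized, and solves the twisting equation
`(Δ ⊗ id)(Φ) Φ₁₂ = (id ⊗ Δ)(Φ) Φ₂₃`. -/
structure IsTwistingCocycle (Φ : TensorBialgebraSq K A) : Prop where
  isUnit : IsUnit Φ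
  counit_left : ∀ n, Φ 0 n = 1
  counit_right : ∀ m, Φ m 0 = 1
  twist : ∀ m n k : ℕ,
    (deconcat K A m n).rTensor (⨂[K]^k A) (Φ (m + n) k) * (Φ m n ⊗ₜ[K] 1) =
      (TensorProduct.assoc K (⨂[K]^m A) (⨂[K]^n A) (⨂[K]^k A)).symm
          ((deconcat K A n k).lTensor (⨂[K]^m A) (Φ m (n + k))) *
        (TensorProduct.assoc K (⨂[K]^m A) (⨂[K]^n A) (⨂[K]^k A)).symm (1 ⊗ₜ[K] Φ n k)

/-- The ordered product `F₁₂ F₁₃ ⋯ F₁₍ₖ₊₁₎` in `A ⊗ A^{⊗k}` for `F` in `A ⊗ A`. -/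
def splitProduct (F : A ⊗[K] A) (k : ℕ) : (⨂[K]^1 A) ⊗[K] (⨂[K]^k A) :=
  (List.ofFn fun j : Fin k =>
    Algebra.TensorProduct.map
      (PiTensorProduct.singleAlgHom (R := K) (A := fun _ : Fin 1 => A) 0)
      (PiTensorProduct.singleAlgHom (R := K) (A := fun _ : Fin k => A) j) F).prod

/-- `Φ` is the twisting cocycle obtained from `F` in `A ⊗ A` by the modified Reshetikhin
procedure: the twisting cocycle with components `Φ^{1,k} = F₁₂ F₁₃ ⋯ F₁₍ₖ₊₁₎`. -/
structure IsReshetikhinExpansion (F : A ⊗[K] A) (Φ : TensorBialgebraSq K A) : Prop where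
  isTwistingCocycle : IsTwistingCocycle Φ
  one_apply : ∀ k, Φ 1 k = splitProduct F k

end Twist

section Rep

variable (K L : Type*) [Field K] [NonUnitalRing L] [Module K L]
  [IsScalarTower K L L] [SMulCommClass K L L]

attribute [local instance 100] LieRing.ofAssociativeRing

/-- The Lie algebra map `x ↦ ∑ᵢ 1 ⊗ ⋯ ⊗ x ⊗ ⋯ ⊗ 1` from `L ▷ L*` to `R^{⊗n}`. -/
def primitiveHom (n : ℕ) : SemidirectRing K L →ₗ⁅K⁆ (⨂[K]^n (RingR K L)) where
  toLinearMap := ∑ i : Fin n,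
    (PiTensorProduct.singleAlgHom (R := K) (A := fun _ : Fin n => RingR K L) i).toLinearMap ∘ₗ
      Unitization.inrHom K K (SemidirectRing K L)
  map_lie' {x y} := by
    have hc : ∀ i j : Fin n, i ≠ j → ∀ a b : RingR K L,
        Commute (PiTensorProduct.singleAlgHom (R := K) (A := fun _ : Fin n => RingR K L) i a)
          (PiTensorProduct.singleAlgHom (R := K) (A := fun _ : Fin n => RingR K L) j b) :=
      fun i j hij a b => Commute.tprod
        (Pi.mulSingle_commute (f := fun _ : Fin n => RingR K L) hij a b)
    have key : ∀ i : Fin n, ∑ j : Fin n,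
        (PiTensorProduct.singleAlgHom (R := K) (A := fun _ : Fin n => RingR K L) i (x : RingR K L) *
            PiTensorProduct.singleAlgHom (R := K) (A := fun _ : Fin n => RingR K L) j y -
          PiTensorProduct.singleAlgHom (R := K) (A := fun _ : Fin n => RingR K L) j y *
            PiTensorProduct.singleAlgHom (R := K) (A := fun _ : Fin n => RingR K L) i x) =
        PiTensorProduct.singleAlgHom (R := K) (A := fun _ : Fin n => RingR K L) i
          ((⁅x, y⁆ : SemidirectRing K L) : RingR K L) := by
      intro i
      rw [Finset.sum_eq_single i]
      · rw [SemidirectRing.lie_def, ← map_mul, ← map_mul, ← map_sub]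
        congr 1
        simp [Unitization.inr_mul, Unitization.inr_sub]
      · intro j _ hj
        exact sub_eq_zero.2 (hc i j (Ne.symm hj) _ _)
      · simp
    simp only [AddHom.toFun_eq_coe, LinearMap.coe_toAddHom, LinearMap.sum_apply,
      LinearMap.comp_apply, AlgHom.toLinearMap_apply, Unitization.inrHom_apply,
      LieRing.of_associative_ring_bracket]
    rw [Finset.sum_mul_sum, Finset.sum_mul_sum, Finset.sum_comm (f := fun i j =>
      PiTensorProduct.singleAlgHom (R := K) (A := fun _ : Fin n => RingR K L) i (y : RingR K L) *
        PiTensorProduct.singleAlgHom (R := K) (A := fun _ : Fin n => RingR K L) j x),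
      ← Finset.sum_sub_distrib]
    refine Finset.sum_congr rfl fun i _ => ?_
    rw [← Finset.sum_sub_distrib]
    exact (key i).symm

/-- The component in `R^{⊗n}` of the homomorphism from the universal enveloping algebra to
`T(R)` that extends the inclusions of `L` and `L*` in `R`. -/
def tensorRep (n : ℕ) : EnvR K L →ₐ[K] (⨂[K]^n (RingR K L)) :=
  UniversalEnvelopingAlgebra.lift K (primitiveHom K L n)

end Rep

section Completion

attribute [local instance 100] LieRing.ofAssociativeRing

variable {K L : Type*} [Field K] [NonUnitalRing L] [Module K L]
  [IsScalarTower K L L] [SMulCommClass K L L]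

/-- The element `1 ⊗ 1 - ∑ X^ν ⊗ H_ν` of `R ⊗ R`, where `H_ν` is a basis of `L` and `X^ν` is the
dual basis of `L*`. -/
def phiOneOne {ι : Type*} [Fintype ι] (b : Module.Basis ι K L) : RingR K L ⊗[K] RingR K L :=
  1 ⊗ₜ[K] 1 - ∑ ν,
    (SemidirectRing.ofX K L (b.coord ν) : RingR K L) ⊗ₜ[K] (SemidirectRing.ofH K L (b ν) : RingR K L)

variable (K L)

/-- `L → U(L ▷ L*)`. -/
def envH : L →ₗ[K] EnvR K L :=
  (UniversalEnvelopingAlgebra.ι K (L := SemidirectRing K L)).toLinearMap ∘ₗ SemidirectRing.ofH K L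

/-- `L* → U(L ▷ L*)`. -/
def envX : Module.Dual K L →ₗ[K] EnvR K L :=
  (UniversalEnvelopingAlgebra.ι K (L := SemidirectRing K L)).toLinearMap ∘ₗ SemidirectRing.ofX K L

/-- `U(L)`, the subalgebra generated by `L`. -/
def envL : Subalgebra K (EnvR K L) := Algebra.adjoin K (Set.range (envH K L))

/-- The homogeneous component of degree `d` of `U(L*)`: the span of the products of `d` elements
of `L*`. -/
def envLDual (d : ℕ) : Submodule K (EnvR K L) := (LinearMap.range (envX K L)) ^ d

variable {K L}

/-- The completion `∏_d U_d(L*)` of `U(L*)` is realized inside the formal power series in one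
variable over `U(L ▷ L*)`: the coefficient of index `d` is the term of degree `d`
in the elements of `L*`. -/
def IsSeriesInX (f : PowerSeries (EnvR K L)) : Prop :=
  ∀ d, PowerSeries.coeff d f ∈ envLDual K L d

/-- The completion `∏_d U_d(L*) ⊗ U(L)` of `U(L*) ⊗ U(L)`, realized in the same way. -/
def MemCompletedTensor (F : PowerSeries (EnvR K L ⊗[K] EnvR K L)) : Prop :=
  ∀ d, PowerSeries.coeff d F ∈
    LinearMap.range (TensorProduct.mapIncl (envLDual K L d) (envL K L).toSubmodule)

/-- `f ⊗ u` for a series `f`. -/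
def seriesTmul (f : PowerSeries (EnvR K L)) (u : EnvR K L) :
    PowerSeries (EnvR K L ⊗[K] EnvR K L) :=
  PowerSeries.mk fun d => PowerSeries.coeff d f ⊗ₜ[K] u

variable (K) in
/-- The exponential of a formal power series without constant term, over a possibly
noncommutative algebra. The powers of index above `d` do not contribute in degree `d`. -/
def seriesExp {A : Type*} [Ring A] [Algebra K A] (f : PowerSeries A) : PowerSeries A :=
  PowerSeries.mk fun d =>
    ∑ j ∈ Finset.range (d + 1), ((j.factorial : K)⁻¹) • PowerSeries.coeff d (f ^ j)

/-- The series `F` represents `Φ`: for all `m`, `n` the images in `R^{⊗m} ⊗ R^{⊗n}` of the terms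
of `F` sum up to `Φ m n`, the partial sums being eventually constant. -/
def Represents (F : PowerSeries (EnvR K L ⊗[K] EnvR K L))
    (Φ : TensorBialgebraSq K (RingR K L)) : Prop :=
  ∀ m n : ℕ, ∀ᶠ N in Filter.atTop,
    ∑ d ∈ Finset.range N,
      Algebra.TensorProduct.map (tensorRep K L m) (tensorRep K L n) (PowerSeries.coeff d F) = Φ m n

end Completion

end

/-!
Let `P_j = ∑_ν X^ν ⊗ H_ν` in `R^{⊗m} ⊗ R^{⊗n}`, where `X^ν` acts by `∑ᵢ X̂^ν_i` on the first
factor and `H_ν` by `Ĥ_ν` in the place `j` of the second. The cocycle is `Φ^{m,n} = ∏ⱼ (1 - P_j)`.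

The coproduct splits `P_p` into `a_p + ∑_q b_{q,p}`, where `b_{q,p}` has its `X̂` in the place `q`
of the middle factor and `a_p` has it in the first one. The twisting equation then says that
conjugation with `g = ∏_q (1 - c_q)`, where the `c_q` are the elements `P_q` of the first two
factors, maps `(1 - a_p) (1 - ∑_q b_{q,p})` to `1 - a_p - ∑_q b_{q,p}`. This follows from
`c_q b_{q,p} = 0` and `b_{q,p} c_q = a_p b_{q,p}`, which come from `Ĥ X̂ = 0` and from the
compatibility of `X̂ Ĥ` with the product of `L`.

Uniqueness holds because the twisting equation in degree `(1, n, k)` expresses `Φ^{n+1,k}` through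
`Φ^{n,k}` and the components `Φ^{1,•}`, with `Φ^{1,n}` being invertible.

Since `P_j ^ d` is the image of `∑_ν ξ_ν ⊗ H_ν`, where `ξ_ν` is the coordinate of index `ν` of
`l ↦ l ^ d`, the coordinates `X̃^ν` of `-log (1 - l) = ∑_d l ^ d / d` satisfy
`-∑_ν X̃^ν ⊗ H_ν ↦ ∑ⱼ log (1 - P_j)`. As the `P_j` commute, the exponential is `∏ⱼ (1 - P_j)`.
-/

noncomputable section

section OrderedProducts

variable {Q κ : Type*} [Ring Q]

lemma semiconjBy_prod_one_sub {c : κ → Q} {a b : Q} {q : κ} (hac : ∀ j, Commute a (c j))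
    (hbc : ∀ j, j ≠ q → Commute b (c j)) (h₀ : c q * b = 0) (h₁ : b * c q = a * b)
    {l : List κ} (hl : l.Nodup) (hq : q ∈ l) :
    SemiconjBy (l.map fun j => 1 - c j).prod ((1 - a) * b) b := by
  obtain ⟨l₁, l₂, rfl⟩ := List.append_of_mem hq
  have hq₁ : ∀ j ∈ l₁, j ≠ q := by grind
  have hq₂ : ∀ j ∈ l₂, j ≠ q := by grind
  have before : Commute (l₁.map fun j => 1 - c j).prod b :=
    Commute.list_prod_left _ _ <| List.forall_mem_map.2 fun j hj =>
      (Commute.one_left b).sub_left (hbc j (hq₁ j hj)).symm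
  have after : Commute (l₂.map fun j => 1 - c j).prod ((1 - a) * b) :=
    Commute.list_prod_left _ _ <| List.forall_mem_map.2 fun j hj =>
      (Commute.one_left _).sub_left <|
        ((Commute.one_left _).sub_left (hac j)).symm.mul_right (hbc j (hq₂ j hj)).symm
  have atq : SemiconjBy (1 - c q) ((1 - a) * b) b := by
    have : c q * (a * b) = 0 := by rw [← mul_assoc, ← (hac q).eq, mul_assoc, h₀, mul_zero]
    simp only [SemiconjBy, sub_mul, mul_sub, one_mul, mul_one, h₀, h₁, this, sub_zero]
  rw [List.map_append, List.prod_append, List.map_cons, List.prod_cons]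
  exact SemiconjBy.mul_left before (atq.mul_left after)

lemma semiconjBy_prod_map {g : Q} {u v : κ → Q} (h : ∀ i, SemiconjBy g (u i) (v i))
    (l : List κ) : SemiconjBy g (l.map u).prod (l.map v).prod := by
  induction l with
  | nil => exact SemiconjBy.one_right g
  | cons i l ih => simpa only [List.map_cons, List.prod_cons] using (h i).mul_right ih

lemma prod_map_mul_of_commute {u v : κ → Q} {l : List κ} (hl : l.Nodup)
    (h : ∀ i j, i ≠ j → Commute (u i) (v j)) :
    (l.map fun i => u i * v i).prod = (l.map u).prod * (l.map v).prod := by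
  induction l with
  | nil => simp
  | cons j l ih =>
    rw [List.nodup_cons] at hl
    have hj : Commute (v j) (l.map u).prod :=
      Commute.list_prod_right _ _ <| List.forall_mem_map.2 fun i hi =>
        (h i j (ne_of_mem_of_not_mem hi hl.1)).symm
    simp only [List.map_cons, List.prod_cons, ih hl.2, mul_assoc, hj.left_comm]

lemma prod_one_sub_add_mul_prod_one_sub {n k : ℕ} {c : Fin n → Q} {a : Fin k → Q}
    {b : Fin n → Fin k → Q} (hac : ∀ p j, Commute (a p) (c j))
    (hbc : ∀ q p j, j ≠ q → Commute (b q p) (c j)) (hab : ∀ p q p', p ≠ p' → Commute (a p) (b q p'))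
    (h₀ : ∀ q p, c q * b q p = 0) (h₁ : ∀ q p, b q p * c q = a p * b q p) :
    (List.ofFn fun p => 1 - (a p + ∑ q, b q p)).prod * (List.ofFn fun q => 1 - c q).prod =
      (List.ofFn fun q => 1 - c q).prod * (List.ofFn fun p => 1 - a p).prod *
        (List.ofFn fun p => 1 - ∑ q, b q p).prod := by
  simp only [List.ofFn_eq_map]
  set g := ((List.finRange n).map fun q => 1 - c q).prod
  have hg : ∀ p, SemiconjBy g ((1 - a p) * (1 - ∑ q, b q p)) (1 - (a p + ∑ q, b q p)) := by
    intro p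
    have ha : SemiconjBy g (a p) (a p) :=
      Commute.list_prod_left _ _ <| List.forall_mem_map.2 fun q _ =>
        (Commute.one_left _).sub_left (hac p q).symm
    have hb : SemiconjBy g ((1 - a p) * ∑ q, b q p) (∑ q, b q p) := by
      rw [SemiconjBy, Finset.mul_sum, Finset.mul_sum, Finset.sum_mul]
      exact Finset.sum_congr rfl fun q _ => semiconjBy_prod_one_sub (hac p) (hbc q p) (h₀ q p)
        (h₁ q p) (List.nodup_finRange n) (List.mem_finRange q)
    rw [mul_sub, mul_one, ← sub_sub]
    exact ((SemiconjBy.one_right g).sub_right ha).sub_right hb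
  have hab' : ∀ p p', p ≠ p' → Commute (1 - a p) (1 - ∑ q, b q p') := fun p p' hp =>
    (Commute.one_left _).sub_left <| (Commute.one_right _).sub_right <|
      Commute.sum_right _ _ _ fun q _ => hab p q p' hp
  rw [← (semiconjBy_prod_map hg _).eq, prod_map_mul_of_commute (List.nodup_finRange k) hab',
    mul_assoc]

end OrderedProducts

section DualPairing

variable {K L ι Q : Type*} [CommRing K] [AddCommGroup L] [Module K L] [Fintype ι]
  (b : Module.Basis ι K L) [Ring Q] [Algebra K Q]

/-- The value of `f ⊗ g` at the canonical element `∑ ν, X^ν ⊗ H_ν` of `L* ⊗ L`, multiplied out in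
the algebra `Q`. -/
def dualPairing (f : Module.Dual K L →ₗ[K] Q) (g : L →ₗ[K] Q) : Q :=
  ∑ ν, f (b.coord ν) * g (b ν)

lemma dualPairing_add_left (f f' : Module.Dual K L →ₗ[K] Q) (g : L →ₗ[K] Q) :
    dualPairing b (f + f') g = dualPairing b f g + dualPairing b f' g := by
  simp only [dualPairing, LinearMap.add_apply, add_mul, Finset.sum_add_distrib]

lemma dualPairing_sum_left {κ : Type*} (s : Finset κ) (f : κ → Module.Dual K L →ₗ[K] Q)
    (g : L →ₗ[K] Q) : dualPairing b (∑ i ∈ s, f i) g = ∑ i ∈ s, dualPairing b (f i) g := by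
  simp only [dualPairing, LinearMap.sum_apply, Finset.sum_mul, Finset.sum_comm (s := s)]

lemma map_dualPairing {Q' : Type*} [Ring Q'] [Algebra K Q'] (θ : Q →ₐ[K] Q')
    (f : Module.Dual K L →ₗ[K] Q) (g : L →ₗ[K] Q) :
    θ (dualPairing b f g) = dualPairing b (θ.toLinearMap ∘ₗ f) (θ.toLinearMap ∘ₗ g) := by
  simp only [dualPairing, map_sum, map_mul, LinearMap.comp_apply, AlgHom.toLinearMap_apply]

lemma dualPairing_comp_dualMap (f : Module.Dual K L →ₗ[K] Q) (g : L →ₗ[K] Q) (T : L →ₗ[K] L) :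
    dualPairing b (f ∘ₗ T.dualMap) g = dualPairing b f (g ∘ₗ T) := by
  have hcoord : ∀ ν, b.coord ν ∘ₗ T = ∑ σ, b.coord ν (T (b σ)) • b.coord σ := fun ν =>
    (b.sum_dual_apply_smul_coord (b.coord ν ∘ₗ T)).symm
  have hbasis : ∀ ν, T (b ν) = ∑ σ, b.coord σ (T (b ν)) • b σ := fun ν =>
    (b.sum_repr (T (b ν))).symm
  calc ∑ ν, f (b.coord ν ∘ₗ T) * g (b ν)
      = ∑ ν, ∑ σ, b.coord ν (T (b σ)) • (f (b.coord σ) * g (b ν)) := by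
        simp only [hcoord, map_sum, map_smul, Finset.sum_mul, smul_mul_assoc]
    _ = ∑ σ, ∑ ν, b.coord ν (T (b σ)) • (f (b.coord σ) * g (b ν)) := Finset.sum_comm
    _ = ∑ σ, f (b.coord σ) * g (∑ ν, b.coord ν (T (b σ)) • b ν) := by
        simp only [map_sum, map_smul, Finset.mul_sum, mul_smul_comm]
    _ = ∑ σ, f (b.coord σ) * g (T (b σ)) := by simp only [← hbasis]

lemma commute_dualPairing {x : Q} {f : Module.Dual K L →ₗ[K] Q} {g : L →ₗ[K] Q}
    (hf : ∀ ξ, Commute x (f ξ)) (hg : ∀ h, Commute x (g h)) : Commute x (dualPairing b f g) :=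
  Commute.sum_right _ _ _ fun _ _ => (hf _).mul_right (hg _)

lemma commute_dualPairing_dualPairing {f f' : Module.Dual K L →ₗ[K] Q} {g g' : L →ₗ[K] Q}
    (hff' : ∀ ξ ξ', Commute (f ξ) (f' ξ')) (hfg' : ∀ ξ h, Commute (f ξ) (g' h))
    (hgf' : ∀ h ξ, Commute (g h) (f' ξ)) (hgg' : ∀ h h', Commute (g h) (g' h')) :
    Commute (dualPairing b f g) (dualPairing b f' g') :=
  commute_dualPairing b
    (fun ξ' => (commute_dualPairing b (fun ξ => (hff' ξ ξ').symm) fun h => (hgf' h ξ').symm).symm)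
    fun h' => (commute_dualPairing b (fun ξ => (hfg' ξ h').symm) fun h => (hgg' h h').symm).symm

lemma dualPairing_mul_dualPairing_eq_zero {f f' : Module.Dual K L →ₗ[K] Q} {g g' : L →ₗ[K] Q}
    (h₀ : ∀ ξ h ξ', f ξ * g h * f' ξ' = 0) : dualPairing b f g * dualPairing b f' g' = 0 := by
  simp only [dualPairing, Finset.sum_mul_sum, ← mul_assoc, h₀, zero_mul, Finset.sum_const_zero]

end DualPairing

section RingR

variable (K L : Type*) [Field K] [NonUnitalRing L] [Module K L] [SMulCommClass K L L]

/-- The linear map `H_ν ↦ Ĥ_ν` from `L` to the ring `R`. -/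
def hatH : L →ₗ[K] RingR K L :=
  Unitization.inrHom K K (SemidirectRing K L) ∘ₗ SemidirectRing.ofH K L

/-- The linear map `X^ν ↦ X̂^ν` from `L*` to the ring `R`. -/
def hatX : Module.Dual K L →ₗ[K] RingR K L :=
  Unitization.inrHom K K (SemidirectRing K L) ∘ₗ SemidirectRing.ofX K L

variable {K L}

lemma hatH_mul_hatH (h h' : L) : hatH K L h * hatH K L h' = hatH K L (h * h') := by
  refine (Unitization.inr_mul K _ _).symm.trans (congrArg _ ?_)
  exact SemidirectRing.ext' rfl fun _ => rfl

lemma hatX_mul_hatH (ξ : Module.Dual K L) (h : L) :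
    hatX K L ξ * hatH K L h = hatX K L ((LinearMap.mulLeft K h).dualMap ξ) := by
  refine (Unitization.inr_mul K _ _).symm.trans (congrArg _ ?_)
  exact SemidirectRing.ext' (zero_mul h) fun _ => rfl

lemma hatH_mul_hatX (h : L) (ξ : Module.Dual K L) : hatH K L h * hatX K L ξ = 0 := by
  refine (Unitization.inr_mul K _ _).symm.trans (congrArg _ ?_)
  exact SemidirectRing.ext' (mul_zero h) fun _ => rfl

lemma hatX_mul_hatX (ξ ξ' : Module.Dual K L) : hatX K L ξ * hatX K L ξ' = 0 := by
  refine (Unitization.inr_mul K _ _).symm.trans (congrArg _ ?_)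
  exact SemidirectRing.ext' (zero_mul 0) fun l => (congrArg ξ (zero_mul l)).trans (map_zero ξ)

variable [IsScalarTower K L L] {ι Q : Type*} [Fintype ι] (b : Module.Basis ι K L) [Ring Q]
  [Algebra K Q]

lemma dualPairing_hat_mul {e e' : RingR K L →ₐ[K] Q} (hee' : ∀ r s, Commute (e r) (e' s)) (h : L) :
    dualPairing b (e.toLinearMap ∘ₗ hatX K L) (e'.toLinearMap ∘ₗ hatH K L) * e (hatH K L h) =
      e' (hatH K L h) *
        dualPairing b (e.toLinearMap ∘ₗ hatX K L) (e'.toLinearMap ∘ₗ hatH K L) :=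
  calc (∑ ν, e (hatX K L (b.coord ν)) * e' (hatH K L (b ν))) * e (hatH K L h)
      = dualPairing b ((e.toLinearMap ∘ₗ hatX K L) ∘ₗ (LinearMap.mulLeft K h).dualMap)
          (e'.toLinearMap ∘ₗ hatH K L) := by
        simp only [dualPairing, Finset.sum_mul, LinearMap.comp_apply, AlgHom.toLinearMap_apply,
          ← hatX_mul_hatH, map_mul, (hee' _ _).right_comm]
    _ = dualPairing b (e.toLinearMap ∘ₗ hatX K L)
          ((e'.toLinearMap ∘ₗ hatH K L) ∘ₗ LinearMap.mulLeft K h) :=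
        dualPairing_comp_dualMap b _ _ _
    _ = e' (hatH K L h) * ∑ ν, e (hatX K L (b.coord ν)) * e' (hatH K L (b ν)) := by
        simp only [dualPairing, Finset.mul_sum, LinearMap.comp_apply, AlgHom.toLinearMap_apply,
          LinearMap.mulLeft_apply, ← hatH_mul_hatH, map_mul, (hee' _ _).left_comm]

/-- The ordered product of the elements `1 - ∑ ν, u (X^ν) H_ν`, with `H_ν` mapped to `Q` by the
homomorphisms `e j`. All components of the twisting cocycle have this form. -/
def twistProd (u : Module.Dual K L →ₗ[K] Q) {n : ℕ} (e : Fin n → RingR K L →ₐ[K] Q) : Q :=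
  (List.ofFn fun j => 1 - dualPairing b u ((e j).toLinearMap ∘ₗ hatH K L)).prod

lemma map_twistProd {Q' : Type*} [Ring Q'] [Algebra K Q'] (θ : Q →ₐ[K] Q')
    (u : Module.Dual K L →ₗ[K] Q) {n : ℕ} (e : Fin n → RingR K L →ₐ[K] Q) :
    θ (twistProd b u e) = twistProd b (θ.toLinearMap ∘ₗ u) fun j => θ.comp (e j) := by
  rw [twistProd, map_list_prod, List.map_ofFn, twistProd]
  congr 2
  funext j
  rw [Function.comp_apply, map_sub, map_one, map_dualPairing]
  rfl

lemma twistProd_append (u : Module.Dual K L →ₗ[K] Q) {n k : ℕ} (e : Fin n → RingR K L →ₐ[K] Q)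
    (e' : Fin k → RingR K L →ₐ[K] Q) :
    twistProd b u (Fin.append e e') = twistProd b u e * twistProd b u e' := by
  rw [twistProd, List.ofFn_add, List.prod_append]
  simp [twistProd]

lemma twistProd_add_mul_twistProd {u : Module.Dual K L →ₗ[K] Q} {n k : ℕ}
    {e : Fin n → RingR K L →ₐ[K] Q} {e' : Fin k → RingR K L →ₐ[K] Q}
    (huu : ∀ ξ ξ', Commute (u ξ) (u ξ')) (hue : ∀ ξ q r, Commute (u ξ) (e q r))
    (hue' : ∀ ξ p r, Commute (u ξ) (e' p r))
    (hee : ∀ i j, i ≠ j → ∀ r s, Commute (e i r) (e j s))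
    (he'e' : ∀ i j, i ≠ j → ∀ r s, Commute (e' i r) (e' j s))
    (hee' : ∀ i j r s, Commute (e i r) (e' j s)) :
    twistProd b (u + ∑ q, (e q).toLinearMap ∘ₗ hatX K L) e' * twistProd b u e =
      twistProd b u (Fin.append e e') *
        twistProd b (∑ q, (e q).toLinearMap ∘ₗ hatX K L) e' := by
  rw [twistProd_append]
  simp only [twistProd, dualPairing_add_left, dualPairing_sum_left]
  refine prod_one_sub_add_mul_prod_one_sub ?_ ?_ ?_ ?_ ?_
  · exact fun p q => commute_dualPairing_dualPairing b huu (fun ξ _ => hue ξ q _)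
      (fun _ ξ => (hue' ξ p _).symm) fun _ _ => (hee' q p _ _).symm
  · exact fun q p j hj => commute_dualPairing_dualPairing b (fun _ ξ => (hue ξ q _).symm)
      (fun _ _ => hee q j hj.symm _ _) (fun _ ξ => (hue' ξ p _).symm) fun _ _ => (hee' j p _ _).symm
  · exact fun p q p' hp => commute_dualPairing_dualPairing b (fun ξ _ => hue ξ q _)
      (fun ξ _ => hue' ξ p' _) (fun _ _ => (hee' q p _ _).symm) fun _ _ => he'e' p p' hp _ _
  · refine fun q p => dualPairing_mul_dualPairing_eq_zero b fun ξ h ξ' => ?_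
    rw [mul_assoc]
    simp only [LinearMap.comp_apply, AlgHom.toLinearMap_apply, ← map_mul, hatH_mul_hatX, map_zero,
      mul_zero]
  · intro q p
    have hu : ∀ ξ, Commute (dualPairing b ((e q).toLinearMap ∘ₗ hatX K L)
        ((e' p).toLinearMap ∘ₗ hatH K L)) (u ξ) := fun ξ =>
      (commute_dualPairing b (fun ξ' => hue ξ q _) fun h => hue' ξ p _).symm
    conv_lhs => rw [dualPairing.eq_def b u, Finset.mul_sum]
    conv_rhs => rw [dualPairing.eq_def b u, Finset.sum_mul]
    exact Finset.sum_congr rfl fun ν _ => by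
      rw [(hu _).left_comm, mul_assoc]
      exact congrArg _ (dualPairing_hat_mul b (hee' q p) (b ν))

end RingR

section Deconcat

variable {K A : Type*} [Field K] [Ring A] [Algebra K A]

lemma deconcat_tprod {m n : ℕ} (c : Fin (m + n) → A) :
    deconcat K A m n (PiTensorProduct.tprod K c) =
      PiTensorProduct.tprod K (c ∘ Fin.castAdd n) ⊗ₜ[K]
        PiTensorProduct.tprod K (c ∘ Fin.natAdd m) := by
  simp [deconcat, TensorPower.mulEquiv, Function.comp_def]

lemma deconcat_one (m n : ℕ) : deconcat K A m n 1 = 1 :=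
  deconcat_tprod 1

lemma deconcat_mul {m n : ℕ} (x y : ⨂[K]^(m + n) A) :
    deconcat K A m n (x * y) = deconcat K A m n x * deconcat K A m n y := by
  revert x y
  rw [LinearMap.map_mul_iff]
  ext c d
  simp [deconcat_tprod, Pi.mul_comp]

variable (K A) in
/-- The component `deconcat K A m n` of the coproduct as an isomorphism of algebras. -/
def deconcatEquiv (m n : ℕ) : (⨂[K]^(m + n) A) ≃ₐ[K] (⨂[K]^m A) ⊗[K] (⨂[K]^n A) :=
  AlgEquiv.ofLinearEquiv TensorPower.mulEquiv.symm (deconcat_one m n) deconcat_mul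

/-- The inclusion of `A` in the place `i` of `A^{⊗n}`. -/
abbrev place (K : Type*) {A : Type*} [Field K] [Ring A] [Algebra K A] {n : ℕ} (i : Fin n) :
    A →ₐ[K] ⨂[K]^n A :=
  PiTensorProduct.singleAlgHom (R := K) (A := fun _ : Fin n => A) i

lemma commute_place {n : ℕ} {i j : Fin n} (h : i ≠ j) (a b : A) :
    Commute (place K i a) (place K j b) :=
  Commute.tprod (Pi.mulSingle_commute (f := fun _ : Fin n => A) h a b)

lemma deconcatEquiv_place_castAdd {m n : ℕ} (i : Fin m) (a : A) :
    deconcatEquiv K A m n (place K (Fin.castAdd n i) a) = place K i a ⊗ₜ[K] 1 := by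
  have hl : (Pi.mulSingle (Fin.castAdd n i) a : Fin (m + n) → A) ∘ Fin.castAdd n =
      Pi.mulSingle i a := by
    ext j
    simp [Pi.mulSingle_apply]
  have hr : (Pi.mulSingle (Fin.castAdd n i) a : Fin (m + n) → A) ∘ Fin.natAdd m = 1 := by
    ext j
    simp [Fin.ext_iff, show m + j ≠ i by omega]
  exact (deconcat_tprod _).trans
    (congrArg₂ (fun f g => PiTensorProduct.tprod K f ⊗ₜ[K] PiTensorProduct.tprod K g) hl hr)

lemma deconcatEquiv_place_natAdd {m n : ℕ} (i : Fin n) (a : A) :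
    deconcatEquiv K A m n (place K (Fin.natAdd m i) a) = 1 ⊗ₜ[K] place K i a := by
  have hl : (Pi.mulSingle (Fin.natAdd m i) a : Fin (m + n) → A) ∘ Fin.castAdd n = 1 := by
    ext j
    simp [Fin.ext_iff, show (j : ℕ) ≠ m + i by omega]
  have hr : (Pi.mulSingle (Fin.natAdd m i) a : Fin (m + n) → A) ∘ Fin.natAdd m =
      Pi.mulSingle i a := by
    ext j
    simp [Pi.mulSingle_apply]
  exact (deconcat_tprod _).trans
    (congrArg₂ (fun f g => PiTensorProduct.tprod K f ⊗ₜ[K] PiTensorProduct.tprod K g) hl hr)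

variable (K A) in
/-- `Δ ⊗ id` on the components of degree `(m + n, k)`, as an isomorphism of algebras. -/
def deconcatLeft (m n k : ℕ) :
    (⨂[K]^(m + n) A) ⊗[K] (⨂[K]^k A) ≃ₐ[K] ((⨂[K]^m A) ⊗[K] (⨂[K]^n A)) ⊗[K] (⨂[K]^k A) :=
  Algebra.TensorProduct.congr (deconcatEquiv K A m n) AlgEquiv.refl

variable (K A) in
/-- `id ⊗ Δ` on the components of degree `(m, n + k)`, as an isomorphism of algebras. -/
def deconcatRight (m n k : ℕ) :
    (⨂[K]^m A) ⊗[K] (⨂[K]^(n + k) A) ≃ₐ[K] ((⨂[K]^m A) ⊗[K] (⨂[K]^n A)) ⊗[K] (⨂[K]^k A) :=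
  (Algebra.TensorProduct.congr AlgEquiv.refl (deconcatEquiv K A n k)).trans
    (Algebra.TensorProduct.assoc K K K (⨂[K]^m A) (⨂[K]^n A) (⨂[K]^k A)).symm

variable (K A) in
/-- The map `Φ ↦ Φ₁₂` on the components of degree `(m, n)`. -/
def includeOneTwo (m n k : ℕ) :
    (⨂[K]^m A) ⊗[K] (⨂[K]^n A) →ₐ[K] ((⨂[K]^m A) ⊗[K] (⨂[K]^n A)) ⊗[K] (⨂[K]^k A) :=
  Algebra.TensorProduct.includeLeft

variable (K A) in
/-- The map `Φ ↦ Φ₂₃` on the components of degree `(n, k)`. -/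
def includeTwoThree (m n k : ℕ) :
    (⨂[K]^n A) ⊗[K] (⨂[K]^k A) →ₐ[K] ((⨂[K]^m A) ⊗[K] (⨂[K]^n A)) ⊗[K] (⨂[K]^k A) :=
  (Algebra.TensorProduct.assoc K K K (⨂[K]^m A) (⨂[K]^n A) (⨂[K]^k A)).symm.toAlgHom.comp
    Algebra.TensorProduct.includeRight

variable {Φ Ψ : TensorBialgebraSq K A}

lemma IsTwistingCocycle.deconcatLeft_mul_includeOneTwo (hΦ : IsTwistingCocycle Φ) (m n k : ℕ) :
    deconcatLeft K A m n k (Φ (m + n) k) * includeOneTwo K A m n k (Φ m n) =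
      deconcatRight K A m n k (Φ m (n + k)) * includeTwoThree K A m n k (Φ n k) :=
  hΦ.twist m n k

lemma IsTwistingCocycle.eq_of_one_apply_eq (hΦ : IsTwistingCocycle Φ) (hΨ : IsTwistingCocycle Ψ)
    (h : ∀ k, Φ 1 k = Ψ 1 k) : Φ = Ψ := by
  funext m
  induction m with
  | zero =>
    funext n
    rw [hΦ.counit_left, hΨ.counit_left]
  | succ n ih =>
    rw [Nat.add_comm n 1]
    funext k
    have hunit : IsUnit (includeOneTwo K A 1 n k (Φ 1 n)) :=
      RingHom.isUnit_map (includeOneTwo K A 1 n k).toRingHom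
        (Pi.isUnit_iff.1 (Pi.isUnit_iff.1 hΦ.isUnit 1) n)
    have htwist : deconcatLeft K A 1 n k (Φ (1 + n) k) * includeOneTwo K A 1 n k (Φ 1 n) =
        deconcatLeft K A 1 n k (Ψ (1 + n) k) * includeOneTwo K A 1 n k (Φ 1 n) := by
      rw [hΦ.deconcatLeft_mul_includeOneTwo, h, h, ih, hΨ.deconcatLeft_mul_includeOneTwo]
    exact (deconcatLeft K A 1 n k).injective (hunit.mul_left_injective htwist)

lemma IsReshetikhinExpansion.unique {F : A ⊗[K] A} (hΦ : IsReshetikhinExpansion F Φ)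
    (hΨ : IsReshetikhinExpansion F Ψ) : Φ = Ψ :=
  hΦ.isTwistingCocycle.eq_of_one_apply_eq hΨ.isTwistingCocycle fun k =>
    (hΦ.one_apply k).trans (hΨ.one_apply k).symm

lemma isUnit_of_deconcatLeft_mul_includeOneTwo (h₀ : ∀ n, Φ 0 n = 1) (h₁ : ∀ n, IsUnit (Φ 1 n))
    (htwist : ∀ n k, deconcatLeft K A 1 n k (Φ (1 + n) k) * includeOneTwo K A 1 n k (Φ 1 n) =
      deconcatRight K A 1 n k (Φ 1 (n + k)) * includeTwoThree K A 1 n k (Φ n k)) :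
    IsUnit Φ := by
  refine Pi.isUnit_iff.2 fun m => Pi.isUnit_iff.2 ?_
  induction m with
  | zero => exact fun n => h₀ n ▸ isUnit_one
  | succ n ih =>
    rw [Nat.add_comm n 1]
    intro k
    have hΦ₁₂ : IsUnit (includeOneTwo K A 1 n k (Φ 1 n)) :=
      RingHom.isUnit_map (includeOneTwo K A 1 n k).toRingHom (h₁ n)
    have hΦ₂₃ : IsUnit (includeTwoThree K A 1 n k (Φ n k)) :=
      RingHom.isUnit_map (includeTwoThree K A 1 n k).toRingHom (ih k)
    have hleft : IsUnit (deconcatLeft K A 1 n k (Φ (1 + n) k)) :=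
      hΦ₁₂.mul_right_iff.1 (htwist n k ▸ ((h₁ (n + k)).map (deconcatRight K A 1 n k)).mul hΦ₂₃)
    simpa only [AlgEquiv.symm_apply_apply] using hleft.map (deconcatLeft K A 1 n k).symm

end Deconcat

section Cocycle

variable {K L A : Type*} [Field K] [NonUnitalRing L] [Module K L] [SMulCommClass K L L]
  [IsScalarTower K L L] [Ring A] [Algebra K A] (ε : RingR K L →ₐ[K] A)

/-- The linear map `X ↦ ∑ᵢ 1 ⊗ ⋯ ⊗ X̂ ⊗ ⋯ ⊗ 1` from `L*` to `A^{⊗m}`, where `X̂` is mapped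
to `A` by `ε`. -/
def placeSumX (m : ℕ) : Module.Dual K L →ₗ[K] ⨂[K]^m A :=
  ∑ i : Fin m, ((place K i).comp ε).toLinearMap ∘ₗ hatX K L

/-- The map `placeSumX` into the first factor of `A^{⊗m} ⊗ A^{⊗n} ⊗ A^{⊗k}`. -/
def placeSumXFirst (m n k : ℕ) :
    Module.Dual K L →ₗ[K] ((⨂[K]^m A) ⊗[K] (⨂[K]^n A)) ⊗[K] (⨂[K]^k A) :=
  (includeOneTwo K A m n k).toLinearMap ∘ₗ
    Algebra.TensorProduct.includeLeft.toLinearMap ∘ₗ placeSumX ε m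

/-- The homomorphism `ε` into the place `q` of the middle factor of
`A^{⊗m} ⊗ A^{⊗n} ⊗ A^{⊗k}`. -/
def placeMiddle (m n k : ℕ) (q : Fin n) :
    RingR K L →ₐ[K] ((⨂[K]^m A) ⊗[K] (⨂[K]^n A)) ⊗[K] (⨂[K]^k A) :=
  (includeOneTwo K A m n k).comp
    (Algebra.TensorProduct.includeRight.comp ((place K q).comp ε))

/-- The homomorphism `ε` into the place `p` of the last factor of
`A^{⊗m} ⊗ A^{⊗n} ⊗ A^{⊗k}`. -/
def placeLast (m n k : ℕ) (p : Fin k) :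
    RingR K L →ₐ[K] ((⨂[K]^m A) ⊗[K] (⨂[K]^n A)) ⊗[K] (⨂[K]^k A) :=
  Algebra.TensorProduct.includeRight.comp ((place K p).comp ε)

lemma placeSumX_apply (m : ℕ) (ξ : Module.Dual K L) :
    placeSumX ε m ξ = ∑ i : Fin m, place K i (ε (hatX K L ξ)) := by
  simp [placeSumX]

lemma commute_placeSumX (m : ℕ) (ξ ξ' : Module.Dual K L) :
    Commute (placeSumX ε m ξ) (placeSumX ε m ξ') := by
  simp only [placeSumX_apply]
  refine Commute.sum_left _ _ _ fun i _ => Commute.sum_right _ _ _ fun j _ => ?_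
  obtain rfl | hij := eq_or_ne i j
  · have : Commute (hatX K L ξ) (hatX K L ξ') := by
      rw [Commute, SemiconjBy, hatX_mul_hatX, hatX_mul_hatX]
    exact this.map ((place K i).comp ε)
  · exact commute_place hij _ _

lemma deconcatEquiv_placeSumX (m n : ℕ) (ξ : Module.Dual K L) :
    deconcatEquiv K A m n (placeSumX ε (m + n) ξ) =
      placeSumX ε m ξ ⊗ₜ[K] 1 + 1 ⊗ₜ[K] placeSumX ε n ξ := by
  simp only [placeSumX_apply, Fin.sum_univ_add, map_add, map_sum, deconcatEquiv_place_castAdd,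
    deconcatEquiv_place_natAdd, TensorProduct.sum_tmul, TensorProduct.tmul_sum]

lemma placeSumXFirst_apply (m n k : ℕ) (ξ : Module.Dual K L) :
    placeSumXFirst ε m n k ξ = (placeSumX ε m ξ ⊗ₜ[K] 1) ⊗ₜ[K] 1 := rfl

lemma placeMiddle_apply (m n k : ℕ) (q : Fin n) (r : RingR K L) :
    placeMiddle ε m n k q r = (1 ⊗ₜ[K] place K q (ε r)) ⊗ₜ[K] 1 := rfl

lemma sum_placeMiddle_hatX (m n k : ℕ) (ξ : Module.Dual K L) :
    (∑ q, (placeMiddle ε m n k q).toLinearMap ∘ₗ hatX K L) ξ =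
      (1 ⊗ₜ[K] placeSumX ε n ξ) ⊗ₜ[K] 1 := by
  simp only [LinearMap.sum_apply, LinearMap.comp_apply, AlgHom.toLinearMap_apply,
    placeMiddle_apply, placeSumX_apply, TensorProduct.sum_tmul, TensorProduct.tmul_sum]

variable {ι : Type*} [Fintype ι] (b : Module.Basis ι K L)

/-- The element `∑ᵢ ∑_ν X̂^ν_i ⊗ Ĥ_{ν,j}` of `A^{⊗m} ⊗ A^{⊗n}`, where `i` runs through the places
of `A^{⊗m}`, the place `j` of `A^{⊗n}` is fixed, and `R` is mapped to `A` by `ε`. -/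
def pairingAt (m : ℕ) {n : ℕ} (j : Fin n) : (⨂[K]^m A) ⊗[K] (⨂[K]^n A) :=
  dualPairing b (Algebra.TensorProduct.includeLeft.toLinearMap ∘ₗ placeSumX ε m)
    ((Algebra.TensorProduct.includeRight.comp ((place K j).comp ε)).toLinearMap ∘ₗ hatH K L)

/-- The twisting cocycle with the components `∏ⱼ (1 - ∑ᵢ ∑_ν X̂^ν_i ⊗ Ĥ_{ν,j})`, where `i` runs
through the places of `A^{⊗m}` and `j` through those of `A^{⊗n}`, and `R` is mapped to `A`
by `ε`. -/
def cocycle : TensorBialgebraSq K A := fun m n =>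
  twistProd b (Algebra.TensorProduct.includeLeft.toLinearMap ∘ₗ placeSumX ε m) fun j : Fin n =>
    Algebra.TensorProduct.includeRight.comp ((place K j).comp ε)

lemma cocycle_apply (m n : ℕ) :
    cocycle ε b m n = (List.ofFn fun j : Fin n => 1 - pairingAt ε b m j).prod := rfl

lemma commute_pairingAt (m : ℕ) {n : ℕ} (i j : Fin n) :
    Commute (pairingAt ε b m i) (pairingAt ε b m j) := by
  obtain rfl | hij := eq_or_ne i j
  · exact Commute.refl _
  exact commute_dualPairing_dualPairing (Q := (⨂[K]^m A) ⊗[K] (⨂[K]^n A)) b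
    (fun ξ ξ' => (commute_placeSumX ε m ξ ξ').tmul (Commute.refl 1))
    (fun _ _ => (Commute.one_right _).tmul (Commute.one_left _))
    (fun _ _ => (Commute.one_left _).tmul (Commute.one_right _))
    fun _ _ => (Commute.refl 1).tmul (commute_place hij _ _)

lemma deconcatLeft_cocycle (m n k : ℕ) :
    deconcatLeft K A m n k (cocycle ε b (m + n) k) =
      twistProd b
        (placeSumXFirst ε m n k + ∑ q, (placeMiddle ε m n k q).toLinearMap ∘ₗ hatX K L)
        (placeLast ε m n k) := by
  refine (map_twistProd (Q := (⨂[K]^(m + n) A) ⊗[K] (⨂[K]^k A))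
    (Q' := ((⨂[K]^m A) ⊗[K] (⨂[K]^n A)) ⊗[K] (⨂[K]^k A)) b
    (deconcatLeft K A m n k).toAlgHom _ _).trans ?_
  congr 1
  · ext ξ : 1
    rw [LinearMap.add_apply, placeSumXFirst_apply, sum_placeMiddle_hatX, ← TensorProduct.add_tmul,
      ← deconcatEquiv_placeSumX]
    rfl
  · funext p
    refine AlgHom.ext fun r => ?_
    exact congrArg (· ⊗ₜ[K] _) (map_one (deconcatEquiv K A m n))

lemma includeOneTwo_cocycle (m n k : ℕ) :
    includeOneTwo K A m n k (cocycle ε b m n) =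
      twistProd b (placeSumXFirst ε m n k) (placeMiddle ε m n k) :=
  map_twistProd (Q := (⨂[K]^m A) ⊗[K] (⨂[K]^n A))
    (Q' := ((⨂[K]^m A) ⊗[K] (⨂[K]^n A)) ⊗[K] (⨂[K]^k A)) b (includeOneTwo K A m n k) _ _

lemma deconcatRight_cocycle (m n k : ℕ) :
    deconcatRight K A m n k (cocycle ε b m (n + k)) =
      twistProd b (placeSumXFirst ε m n k)
        (Fin.append (placeMiddle ε m n k) (placeLast ε m n k)) := by
  refine (map_twistProd (Q := (⨂[K]^m A) ⊗[K] (⨂[K]^(n + k) A))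
    (Q' := ((⨂[K]^m A) ⊗[K] (⨂[K]^n A)) ⊗[K] (⨂[K]^k A)) b
    (deconcatRight K A m n k).toAlgHom _ _).trans ?_
  congr 1
  · ext ξ : 1
    exact congrArg
      (fun x => (Algebra.TensorProduct.assoc K K K _ _ _).symm (placeSumX ε m ξ ⊗ₜ[K] x))
      (map_one (deconcatEquiv K A n k))
  · funext j
    refine AlgHom.ext fun r => ?_
    refine Fin.addCases (fun q => ?_) (fun p => ?_) j
    · rw [Fin.append_left]
      exact congrArg (fun x => (Algebra.TensorProduct.assoc K K K _ _ _).symm (1 ⊗ₜ[K] x))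
        (deconcatEquiv_place_castAdd q (ε r))
    · rw [Fin.append_right]
      exact congrArg (fun x => (Algebra.TensorProduct.assoc K K K _ _ _).symm (1 ⊗ₜ[K] x))
        (deconcatEquiv_place_natAdd p (ε r))

lemma includeTwoThree_cocycle (m n k : ℕ) :
    includeTwoThree K A m n k (cocycle ε b n k) =
      twistProd b (∑ q, (placeMiddle ε m n k q).toLinearMap ∘ₗ hatX K L)
        (placeLast ε m n k) := by
  refine (map_twistProd (Q := (⨂[K]^n A) ⊗[K] (⨂[K]^k A))
    (Q' := ((⨂[K]^m A) ⊗[K] (⨂[K]^n A)) ⊗[K] (⨂[K]^k A)) b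
    (includeTwoThree K A m n k) _ _).trans ?_
  congr 1
  ext ξ : 1
  exact (sum_placeMiddle_hatX ε m n k ξ).symm

lemma cocycle_twist (m n k : ℕ) :
    deconcatLeft K A m n k (cocycle ε b (m + n) k) * includeOneTwo K A m n k (cocycle ε b m n) =
      deconcatRight K A m n k (cocycle ε b m (n + k)) *
        includeTwoThree K A m n k (cocycle ε b n k) := by
  rw [deconcatLeft_cocycle, includeOneTwo_cocycle, deconcatRight_cocycle, includeTwoThree_cocycle]
  refine twistProd_add_mul_twistProd (Q := ((⨂[K]^m A) ⊗[K] (⨂[K]^n A)) ⊗[K] (⨂[K]^k A)) b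
    (fun ξ ξ' => ?_) (fun ξ q r => ?_) (fun ξ p r => ?_) (fun i j hij r s => ?_)
    (fun i j hij r s => ?_) (fun i j r s => ?_)
  · exact (commute_placeSumX ε m ξ ξ').map
      ((includeOneTwo K A m n k).comp Algebra.TensorProduct.includeLeft)
  · exact ((Commute.one_right (placeSumX ε m ξ)).tmul (Commute.one_left (place K q (ε r)))).map
      (includeOneTwo K A m n k)
  · exact (Commute.one_right _).tmul (Commute.one_left _)
  · exact (commute_place hij (ε r) (ε s)).map
      ((includeOneTwo K A m n k).comp Algebra.TensorProduct.includeRight)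
  · exact (commute_place hij (ε r) (ε s)).map Algebra.TensorProduct.includeRight
  · exact (Commute.one_right _).tmul (Commute.one_left _)

lemma cocycle_zero_left (n : ℕ) : cocycle ε b 0 n = 1 := by
  simp [cocycle, twistProd, placeSumX, dualPairing]

lemma cocycle_zero_right (m : ℕ) : cocycle ε b m 0 = 1 := by
  simp [cocycle, twistProd]

lemma isUnit_cocycle_one_left (k : ℕ) : IsUnit (cocycle ε b 1 k) := by
  refine List.prod_isUnit fun x hx => ?_
  obtain ⟨j, rfl⟩ := List.mem_ofFn.1 hx
  refine IsNilpotent.isUnit_one_sub ⟨2, ?_⟩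
  rw [sq]
  refine dualPairing_mul_dualPairing_eq_zero b fun ξ h ξ' => ?_
  simp only [LinearMap.comp_apply, AlgHom.toLinearMap_apply, AlgHom.comp_apply, placeSumX_apply,
    Fin.sum_univ_one, Algebra.TensorProduct.includeLeft_apply,
    Algebra.TensorProduct.includeRight_apply, Algebra.TensorProduct.tmul_mul_tmul, mul_one,
    ← map_mul, hatX_mul_hatX, map_zero, TensorProduct.zero_tmul]

lemma cocycle_one_left (k : ℕ) :
    cocycle ε b 1 k = splitProduct (Algebra.TensorProduct.map ε ε (phiOneOne b)) k := by
  rw [cocycle, twistProd, splitProduct]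
  congr 2
  funext j
  rw [phiOneOne, map_sub, map_sub, map_sum, map_sum, ← Algebra.TensorProduct.one_def, map_one,
    map_one, dualPairing]
  congr 1
  refine Finset.sum_congr rfl fun ν _ => ?_
  rw [LinearMap.comp_apply, AlgHom.toLinearMap_apply, placeSumX_apply, Fin.sum_univ_one,
    LinearMap.comp_apply, AlgHom.toLinearMap_apply, AlgHom.comp_apply,
    Algebra.TensorProduct.includeLeft_apply, Algebra.TensorProduct.includeRight_apply,
    Algebra.TensorProduct.tmul_mul_tmul, mul_one, one_mul]
  rfl

lemma isReshetikhinExpansion_cocycle :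
    IsReshetikhinExpansion (Algebra.TensorProduct.map ε ε (phiOneOne b)) (cocycle ε b) where
  isTwistingCocycle :=
    { isUnit := isUnit_of_deconcatLeft_mul_includeOneTwo (cocycle_zero_left ε b)
        (isUnit_cocycle_one_left ε b) (cocycle_twist ε b 1)
      counit_left := cocycle_zero_left ε b
      counit_right := cocycle_zero_right ε b
      twist := cocycle_twist ε b }
  one_apply := cocycle_one_left ε b

lemma isReshetikhinExpansion_cocycle_id :
    IsReshetikhinExpansion (phiOneOne b) (cocycle (AlgHom.id K (RingR K L)) b) := by
  simpa only [Algebra.TensorProduct.map_id, AlgHom.id_apply] using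
    isReshetikhinExpansion_cocycle (AlgHom.id K (RingR K L)) b

end Cocycle

section Exponential

variable {K : Type*} [Field K]

lemma map_seriesExp {A B : Type*} [Ring A] [Algebra K A] [Ring B] [Algebra K B] (θ : A →ₐ[K] B)
    (f : PowerSeries A) :
    PowerSeries.map (θ : A →+* B) (seriesExp K f) =
      seriesExp K (PowerSeries.map (θ : A →+* B) f) := by
  ext d
  simp only [seriesExp, PowerSeries.coeff_map, PowerSeries.coeff_mk, ← map_pow, map_sum,
    RingHom.coe_coe, map_smul]

lemma coeff_pow_eq_zero_of_lt {A : Type*} [Semiring A] {f : PowerSeries A}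
    (hf : PowerSeries.constantCoeff f = 0) {d j : ℕ} (h : d < j) :
    PowerSeries.coeff d (f ^ j) = 0 := by
  induction j generalizing d with
  | zero => simp at h
  | succ j ih =>
    rw [pow_succ, PowerSeries.coeff_mul]
    refine Finset.sum_eq_zero fun x hx => ?_
    rw [Finset.HasAntidiagonal.mem_antidiagonal] at hx
    by_cases hx2 : x.2 = 0
    · rw [hx2, PowerSeries.coeff_zero_eq_constantCoeff_apply, hf, mul_zero]
    · rw [ih (by omega), zero_mul]

lemma coeff_seriesExp {A : Type*} [Ring A] [Algebra K A] {f : PowerSeries A}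
    (hf : PowerSeries.constantCoeff f = 0) {d N : ℕ} (h : d < N) :
    PowerSeries.coeff d (seriesExp K f) =
      PowerSeries.coeff d (∑ j ∈ Finset.range N, ((j.factorial : K)⁻¹) • f ^ j) := by
  simp only [seriesExp, PowerSeries.coeff_mk, map_sum, PowerSeries.coeff_smul]
  refine Finset.sum_subset (Finset.range_subset_range.2 h) fun j _ hj => ?_
  rw [coeff_pow_eq_zero_of_lt hf (by simpa using hj), smul_zero]

variable (K) in
/-- The series `∑ⱼ log (1 - cⱼ X)`. The formula for its coefficients also covers the vanishing
constant term since `(0 : K)⁻¹ = 0`. -/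
def sumLogOneSub {κ Q : Type*} [Fintype κ] [Ring Q] [Algebra K Q] (c : κ → Q) : PowerSeries Q :=
  PowerSeries.mk fun d => -((d : K)⁻¹ • ∑ j, c j ^ d)

lemma constantCoeff_sumLogOneSub {κ Q : Type*} [Fintype κ] [Ring Q] [Algebra K Q] (c : κ → Q) :
    PowerSeries.constantCoeff (sumLogOneSub K c) = 0 := by
  simp [sumLogOneSub, ← PowerSeries.coeff_zero_eq_constantCoeff_apply]

lemma map_sumLogOneSub {κ A B : Type*} [Fintype κ] [Ring A] [Algebra K A] [Ring B] [Algebra K B]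
    (θ : A →ₐ[K] B) (c : κ → A) :
    PowerSeries.map (θ : A →+* B) (sumLogOneSub K c) = sumLogOneSub K fun j => θ (c j) := by
  ext d
  simp only [sumLogOneSub, PowerSeries.coeff_map, PowerSeries.coeff_mk, RingHom.coe_coe, map_neg,
    map_smul, map_sum, map_pow]

lemma eventually_sum_coeff_coe {A : Type*} [Semiring A] (p : Polynomial A) :
    ∀ᶠ N in Filter.atTop,
      ∑ d ∈ Finset.range N, PowerSeries.coeff d (p : PowerSeries A) = p.eval 1 := by
  filter_upwards [Filter.eventually_gt_atTop p.natDegree] with N hN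
  simp only [Polynomial.eval_eq_sum_range' hN, one_pow, mul_one, Polynomial.coeff_coe]

lemma eq_of_derivative_eq_mul {C : Type*} [CommRing C] (hu : ∀ d : ℕ, IsUnit ((d : C) + 1))
    {f g h : PowerSeries C} (hf : PowerSeries.derivative C f = h * f)
    (hg : PowerSeries.derivative C g = h * g)
    (h₀ : PowerSeries.constantCoeff f = PowerSeries.constantCoeff g) : f = g := by
  ext d
  induction d using Nat.strong_induction_on with
  | _ d ih =>
    cases d with
    | zero => simpa using h₀
    | succ d =>
      refine (hu d).mul_left_injective ?_
      simp only [← PowerSeries.coeff_derivative, hf, hg, PowerSeries.coeff_mul]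
      refine Finset.sum_congr rfl fun x hx => ?_
      rw [ih x.2 (Finset.Nat.antidiagonal.snd_lt hx)]

lemma derivative_prod_eq_sum_mul_prod {κ C : Type*} [CommRing C] (s : Finset κ)
    {u h : κ → PowerSeries C} (hu : ∀ j, PowerSeries.derivative C (u j) = h j * u j) :
    PowerSeries.derivative C (∏ j ∈ s, u j) = (∑ j ∈ s, h j) * ∏ j ∈ s, u j := by
  induction s using Finset.cons_induction with
  | empty => simp
  | cons j s hj ih =>
    rw [Finset.prod_cons, Derivation.leibniz, hu, ih, Finset.sum_cons, smul_eq_mul, smul_eq_mul]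
    ring

lemma derivative_one_sub_C_mul_X {C : Type*} [CommRing C] (c : C) :
    PowerSeries.derivative C (1 - PowerSeries.C c * PowerSeries.X) =
      PowerSeries.mk (fun d => -c ^ (d + 1)) * (1 - PowerSeries.C c * PowerSeries.X) := by
  have hD : PowerSeries.derivative C (1 - PowerSeries.C c * PowerSeries.X) = -PowerSeries.C c := by
    simp
  rw [hD, mul_sub, mul_one, mul_left_comm]
  ext d
  cases d with
  | zero => simp
  | succ d =>
    rw [map_neg, PowerSeries.coeff_succ_C, map_sub, PowerSeries.coeff_C_mul,
      PowerSeries.coeff_succ_mul_X, PowerSeries.coeff_mk, PowerSeries.coeff_mk]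
    ring

section CommRing

variable [CharZero K] {κ C : Type*} [Fintype κ] [CommRing C] [Algebra K C]

lemma derivative_sum_inv_factorial_smul_pow (f : PowerSeries C) (N : ℕ) :
    PowerSeries.derivative C (∑ j ∈ Finset.range (N + 1), ((j.factorial : K)⁻¹) • f ^ j) =
      PowerSeries.derivative C f * ∑ j ∈ Finset.range N, ((j.factorial : K)⁻¹) • f ^ j := by
  rw [Finset.sum_range_succ', map_add, map_sum, Derivation.map_smul_of_tower, pow_zero,
    PowerSeries.derivative_one, smul_zero, add_zero, Finset.mul_sum]
  refine Finset.sum_congr rfl fun j _ => ?_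
  have hj : ((j + 1).factorial : K)⁻¹ * ((j + 1 : ℕ) : K) = (j.factorial : K)⁻¹ := by
    rw [Nat.factorial_succ, Nat.cast_mul, mul_inv_rev, mul_assoc,
      inv_mul_cancel₀ (Nat.cast_ne_zero.2 j.succ_ne_zero), mul_one]
  rw [Derivation.map_smul_of_tower, Derivation.leibniz_pow, Nat.add_sub_cancel,
    ← Nat.cast_smul_eq_nsmul K, smul_smul, hj, smul_eq_mul, mul_smul_comm, mul_comm]

lemma derivative_seriesExp {f : PowerSeries C} (hf : PowerSeries.constantCoeff f = 0) :
    PowerSeries.derivative C (seriesExp K f) =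
      PowerSeries.derivative C f * seriesExp K f := by
  ext d
  rw [PowerSeries.coeff_derivative, coeff_seriesExp hf (Nat.lt_succ_self (d + 1)),
    ← PowerSeries.coeff_derivative, derivative_sum_inv_factorial_smul_pow, PowerSeries.coeff_mul,
    PowerSeries.coeff_mul]
  refine Finset.sum_congr rfl fun x hx => ?_
  rw [coeff_seriesExp hf (Finset.Nat.antidiagonal.snd_lt hx)]

lemma derivative_sumLogOneSub (c : κ → C) :
    PowerSeries.derivative C (sumLogOneSub K c) =
      ∑ j, PowerSeries.mk fun d => -c j ^ (d + 1) := by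
  ext d
  have hd : (d : C) + 1 = algebraMap K C ((d + 1 : ℕ) : K) := by simp
  rw [PowerSeries.coeff_derivative, sumLogOneSub, PowerSeries.coeff_mk, map_sum, mul_comm, hd,
    ← Algebra.smul_def, smul_neg, smul_smul,
    mul_inv_cancel₀ (Nat.cast_ne_zero.2 d.succ_ne_zero), one_smul]
  simp only [PowerSeries.coeff_mk, Finset.sum_neg_distrib]

lemma seriesExp_sumLogOneSub (c : κ → C) :
    seriesExp K (sumLogOneSub K c) = ∏ j, (1 - PowerSeries.C (c j) * PowerSeries.X) := by
  have hu : ∀ d : ℕ, IsUnit ((d : C) + 1) := fun d => by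
    simpa using (IsUnit.mk0 ((d : K) + 1) (Nat.cast_add_one_ne_zero d)).map (algebraMap K C)
  refine eq_of_derivative_eq_mul hu (derivative_seriesExp (constantCoeff_sumLogOneSub c)) ?_ ?_
  · rw [derivative_sumLogOneSub]
    exact derivative_prod_eq_sum_mul_prod _ fun j => derivative_one_sub_C_mul_X (c j)
  · rw [map_prod, ← PowerSeries.coeff_zero_eq_constantCoeff_apply]
    simp [seriesExp]

lemma eventually_sum_coeff_seriesExp_sumLogOneSub (c : κ → C) :
    ∀ᶠ N in Filter.atTop,
      ∑ d ∈ Finset.range N, PowerSeries.coeff d (seriesExp K (sumLogOneSub K c)) =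
        ∏ j, (1 - c j) := by
  have hcoe : seriesExp K (sumLogOneSub K c) =
      ((∏ j, (1 - Polynomial.C (c j) * Polynomial.X) : Polynomial C) : PowerSeries C) := by
    rw [seriesExp_sumLogOneSub, ← Polynomial.coeToPowerSeries.ringHom_apply, map_prod]
    simp
  have heval : (∏ j, (1 - Polynomial.C (c j) * Polynomial.X) : Polynomial C).eval 1 =
      ∏ j, (1 - c j) := by
    simp [Polynomial.eval_prod]
  rw [hcoe, ← heval]
  exact eventually_sum_coeff_coe _

end CommRing

open scoped IsMulCommutative in
lemma eventually_sum_coeff_seriesExp_sumLogOneSub_of_commute [CharZero K] {Q : Type*} [Ring Q]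
    [Algebra K Q] {n : ℕ} {c : Fin n → Q} (hc : ∀ i j, Commute (c i) (c j)) :
    ∀ᶠ N in Filter.atTop,
      ∑ d ∈ Finset.range N, PowerSeries.coeff d (seriesExp K (sumLogOneSub K c)) =
        (List.ofFn fun j => 1 - c j).prod := by
  let S := Algebra.adjoin K (Set.range c)
  have : IsMulCommutative S :=
    Algebra.isMulCommutative_adjoin K (Set.forall_mem_range.2 fun i =>
      Set.forall_mem_range.2 (hc i))
  let c' : Fin n → S := fun j => ⟨c j, Algebra.subset_adjoin ⟨j, rfl⟩⟩
  have hexp : PowerSeries.map (S.val : S →+* Q) (seriesExp K (sumLogOneSub K c')) =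
      seriesExp K (sumLogOneSub K c) := by
    rw [map_seriesExp, map_sumLogOneSub]
    rfl
  have hprod : S.val (∏ j, (1 - c' j)) = (List.ofFn fun j => 1 - c j).prod := by
    rw [← List.prod_ofFn, map_list_prod, List.map_ofFn]
    rfl
  filter_upwards [eventually_sum_coeff_seriesExp_sumLogOneSub (K := K) c'] with N hN
  rw [← hexp, ← hprod, ← hN, map_sum]
  rfl

end Exponential

section Graded

variable {K A : Type*} [Ring A] {f : PowerSeries A}

lemma coeff_pow_mem [CommSemiring K] [Algebra K A] {𝒜 : ℕ → Submodule K A}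
    [SetLike.GradedMonoid 𝒜] (hf : ∀ d, PowerSeries.coeff d f ∈ 𝒜 d) (j d : ℕ) :
    PowerSeries.coeff d (f ^ j) ∈ 𝒜 d := by
  induction j generalizing d with
  | zero =>
    rw [pow_zero, PowerSeries.coeff_one]
    split_ifs with hd
    · exact hd ▸ SetLike.GradedOne.one_mem
    · exact Submodule.zero_mem _
  | succ j ih =>
    rw [pow_succ, PowerSeries.coeff_mul]
    refine Submodule.sum_mem _ fun x hx => ?_
    rw [← Finset.HasAntidiagonal.mem_antidiagonal.1 hx]
    exact SetLike.GradedMul.mul_mem (ih x.1) (hf x.2)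

lemma coeff_seriesExp_mem [Field K] [Algebra K A] {𝒜 : ℕ → Submodule K A}
    [SetLike.GradedMonoid 𝒜] (hf : ∀ d, PowerSeries.coeff d f ∈ 𝒜 d) (d : ℕ) :
    PowerSeries.coeff d (seriesExp K f) ∈ 𝒜 d := by
  rw [seriesExp, PowerSeries.coeff_mk]
  exact Submodule.sum_mem _ fun j _ => Submodule.smul_mem _ _ (coeff_pow_mem hf j d)

end Graded

section CompletedTensor

lemma gradedMonoid_range_mapIncl {K A B : Type*} [CommRing K] [Ring A] [Algebra K A] [Ring B]
    [Algebra K B] (W : Submodule K A) (S : Subalgebra K B) :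
    SetLike.GradedMonoid fun d : ℕ =>
      LinearMap.range (TensorProduct.mapIncl (W ^ d) S.toSubmodule) where
  one_mem := ⟨⟨1, pow_zero W ▸ Submodule.one_le.1 le_rfl⟩ ⊗ₜ[K] ⟨1, S.one_mem⟩, rfl⟩
  mul_mem d e x y hx hy := by
    rw [TensorProduct.range_mapIncl, Submodule.map₂_eq_span_image2] at hx hy ⊢
    have hxy := Submodule.mul_mem_mul hx hy
    rw [Submodule.span_mul_span] at hxy
    refine Submodule.span_mono ?_ hxy
    rintro _ ⟨_, ⟨a, ha, u, hu, rfl⟩, _, ⟨a', ha', u', hu', rfl⟩, rfl⟩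
    exact ⟨a * a', pow_add W d e ▸ Submodule.mul_mem_mul ha ha', u * u', S.mul_mem hu hu',
      (Algebra.TensorProduct.tmul_mul_tmul a a' u u').symm⟩

variable {K L : Type*} [Field K] [NonUnitalRing L] [Module K L] [IsScalarTower K L L]
  [SMulCommClass K L L]

lemma MemCompletedTensor.seriesExp {F : PowerSeries (EnvR K L ⊗[K] EnvR K L)}
    (hF : MemCompletedTensor F) : MemCompletedTensor (seriesExp K F) :=
  have : SetLike.GradedMonoid fun d =>
      LinearMap.range (TensorProduct.mapIncl (envLDual K L d) (envL K L).toSubmodule) :=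
    gradedMonoid_range_mapIncl (LinearMap.range (envX K L)) (envL K L)
  coeff_seriesExp_mem hF

lemma coeff_neg_sum_seriesTmul {κ : Type*} (s : Finset κ) (f : κ → PowerSeries (EnvR K L))
    (u : κ → EnvR K L) (d : ℕ) :
    PowerSeries.coeff d (-∑ ν ∈ s, seriesTmul (f ν) (u ν)) =
      -∑ ν ∈ s, PowerSeries.coeff d (f ν) ⊗ₜ[K] u ν := by
  simp only [map_neg, map_sum, seriesTmul, PowerSeries.coeff_mk]

lemma memCompletedTensor_neg_sum_seriesTmul {κ : Type*} (s : Finset κ)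
    {f : κ → PowerSeries (EnvR K L)} {u : κ → EnvR K L} (hf : ∀ ν, IsSeriesInX (f ν))
    (hu : ∀ ν, u ν ∈ envL K L) : MemCompletedTensor (-∑ ν ∈ s, seriesTmul (f ν) (u ν)) := by
  intro d
  rw [coeff_neg_sum_seriesTmul]
  exact Submodule.neg_mem _ (Submodule.sum_mem _ fun ν _ =>
    ⟨⟨_, hf ν d⟩ ⊗ₜ[K] ⟨_, hu ν⟩, rfl⟩)

end CompletedTensor

section DualPow

variable {K L ι Q : Type*} [CommRing K] [NonUnitalNonAssocRing L] [Module K L]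
  [IsScalarTower K L L] [Fintype ι] (b : Module.Basis ι K L) [Ring Q] [Algebra K Q]
  (f : Module.Dual K L →ₗ[K] Q)

/-- The map that sends a linear form `ξ` to the function `l ↦ ξ (l ^ (d + 1))` on `L`, written as
a polynomial of degree `d + 1` in linear forms, which are mapped to `Q` by `f`. As `L` need not
have an identity, there is no power of exponent `0`. -/
def dualPow : ℕ → (Module.Dual K L →ₗ[K] Q)
  | 0 => f
  | d + 1 => ∑ μ, LinearMap.mulRight K (f (b.coord μ)) ∘ₗ dualPow d ∘ₗ
      (LinearMap.mulRight K (b μ)).dualMap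

lemma dualPow_succ_apply (d : ℕ) (ξ : Module.Dual K L) :
    dualPow b f (d + 1) ξ =
      ∑ μ, dualPow b f d ((LinearMap.mulRight K (b μ)).dualMap ξ) * f (b.coord μ) := by
  simp [dualPow]

lemma map_dualPow_apply {Q' : Type*} [Ring Q'] [Algebra K Q'] (θ : Q →ₐ[K] Q') (d : ℕ)
    (ξ : Module.Dual K L) : θ (dualPow b f d ξ) = dualPow b (θ.toLinearMap ∘ₗ f) d ξ := by
  induction d generalizing ξ with
  | zero => rfl
  | succ d ih =>
    simp only [dualPow_succ_apply, map_sum, map_mul, ih, LinearMap.comp_apply,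
      AlgHom.toLinearMap_apply]

lemma dualPow_apply_mem (d : ℕ) (ξ : Module.Dual K L) :
    dualPow b f d ξ ∈ LinearMap.range f ^ (d + 1) := by
  induction d generalizing ξ with
  | zero =>
    rw [zero_add, pow_one]
    exact ⟨ξ, rfl⟩
  | succ d ih =>
    rw [dualPow_succ_apply, pow_succ]
    exact Submodule.sum_mem _ fun μ _ => Submodule.mul_mem_mul (ih _) ⟨_, rfl⟩

lemma dualPairing_dualPow {f : Module.Dual K L →ₗ[K] Q} {g : L →ₗ[K] Q}
    (hg : ∀ h h', g (h * h') = g h * g h') (hfg : ∀ ξ h, Commute (f ξ) (g h)) (d : ℕ) :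
    dualPairing b (dualPow b f d) g = dualPairing b f g ^ (d + 1) := by
  induction d with
  | zero => rw [zero_add, pow_one, dualPow]
  | succ d ih =>
    have hμ : ∀ μ, dualPairing b (dualPow b f d ∘ₗ (LinearMap.mulRight K (b μ)).dualMap) g =
        dualPairing b (dualPow b f d) g * g (b μ) := fun μ => by
      rw [dualPairing_comp_dualMap]
      simp only [dualPairing, LinearMap.comp_apply, LinearMap.mulRight_apply, hg, ← mul_assoc,
        Finset.sum_mul]
    calc ∑ ν, dualPow b f (d + 1) (b.coord ν) * g (b ν)
        = ∑ μ, dualPairing b (dualPow b f d ∘ₗ (LinearMap.mulRight K (b μ)).dualMap) g *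
            f (b.coord μ) := by
          simp only [dualPairing, dualPow_succ_apply, Finset.sum_mul, LinearMap.comp_apply,
            (hfg _ _).right_comm]
          exact Finset.sum_comm
      _ = dualPairing b (dualPow b f d) g * dualPairing b f g := by
          simp only [hμ, mul_assoc, ← (hfg _ _).eq, dualPairing.eq_def b f, Finset.mul_sum]
      _ = dualPairing b f g ^ (d + 2) := by rw [ih, ← pow_succ]

end DualPow

section Logarithm

attribute [local instance 100] LieRing.ofAssociativeRing

variable {K L : Type*} [Field K] [NonUnitalRing L] [Module K L] [IsScalarTower K L L]
  [SMulCommClass K L L] {ι : Type*} [Fintype ι] (b : Module.Basis ι K L)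

/-- The coordinate of index `ν` of `-log (1 - l) = ∑ l ^ d / d` as a power series in the
coordinates of `l ∈ L`. The constant term vanishes since `(0 : K)⁻¹ = 0`. -/
def logSeries (ν : ι) : PowerSeries (EnvR K L) :=
  PowerSeries.mk fun d => (d : K)⁻¹ • dualPow b (envX K L) (d - 1) (b.coord ν)

lemma constantCoeff_logSeries (ν : ι) : PowerSeries.constantCoeff (logSeries b ν) = 0 := by
  simp [logSeries, ← PowerSeries.coeff_zero_eq_constantCoeff_apply]

lemma isSeriesInX_logSeries (ν : ι) : IsSeriesInX (logSeries b ν)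
  | 0 => by
    rw [PowerSeries.coeff_zero_eq_constantCoeff_apply, constantCoeff_logSeries]
    exact Submodule.zero_mem _
  | d + 1 => by
    rw [logSeries, PowerSeries.coeff_mk]
    exact Submodule.smul_mem _ _ (dualPow_apply_mem b (envX K L) d (b.coord ν))

lemma tensorRep_ι (n : ℕ) (x : SemidirectRing K L) :
    tensorRep K L n (UniversalEnvelopingAlgebra.ι K x) =
      ∑ j : Fin n, place K j (x : RingR K L) := by
  rw [tensorRep, UniversalEnvelopingAlgebra.lift_ι_apply]
  exact LinearMap.sum_apply _ _ _

lemma tensorRep_envH (n : ℕ) (h : L) :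
    tensorRep K L n (envH K L h) = ∑ j : Fin n, place K j (hatH K L h) :=
  tensorRep_ι n _

lemma tensorRep_comp_envX (m : ℕ) :
    (tensorRep K L m).toLinearMap ∘ₗ envX K L = placeSumX (AlgHom.id K (RingR K L)) m := by
  refine LinearMap.ext fun ξ => ?_
  rw [placeSumX_apply]
  exact tensorRep_ι m _

lemma sum_dualPow_placeSumX_tmul {A : Type*} [Ring A] [Algebra K A] (ε : RingR K L →ₐ[K] A)
    (m : ℕ) {n : ℕ} (j : Fin n) (d : ℕ) :
    ∑ ν, dualPow b (placeSumX ε m) d (b.coord ν) ⊗ₜ[K] place K j (ε (hatH K L (b ν))) =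
      pairingAt ε b m j ^ (d + 1) := by
  have hmap := map_dualPow_apply (Q' := (⨂[K]^m A) ⊗[K] (⨂[K]^n A)) b (placeSumX ε m)
    Algebra.TensorProduct.includeLeft d
  have hpow := dualPairing_dualPow (Q := (⨂[K]^m A) ⊗[K] (⨂[K]^n A)) b
    (f := Algebra.TensorProduct.includeLeft.toLinearMap ∘ₗ placeSumX ε m)
    (g := (Algebra.TensorProduct.includeRight.comp ((place K j).comp ε)).toLinearMap ∘ₗ hatH K L)
    (fun h h' => by
      simp only [LinearMap.comp_apply, AlgHom.toLinearMap_apply, ← hatH_mul_hatH, map_mul])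
    (fun _ _ => (Commute.one_right _).tmul (Commute.one_left _)) d
  rw [pairingAt, ← hpow, dualPairing]
  refine Finset.sum_congr rfl fun ν _ => ?_
  rw [← hmap, Algebra.TensorProduct.includeLeft_apply, LinearMap.comp_apply,
    AlgHom.toLinearMap_apply, AlgHom.comp_apply, Algebra.TensorProduct.includeRight_apply,
    Algebra.TensorProduct.tmul_mul_tmul, mul_one, one_mul, AlgHom.comp_apply]

lemma map_tensorRep_neg_sum_seriesTmul_logSeries (m n : ℕ) :
    PowerSeries.map
        (Algebra.TensorProduct.map (tensorRep K L m) (tensorRep K L n) :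
          EnvR K L ⊗[K] EnvR K L →+* (⨂[K]^m (RingR K L)) ⊗[K] (⨂[K]^n (RingR K L)))
        (-∑ ν, seriesTmul (logSeries b ν) (envH K L (b ν))) =
      sumLogOneSub K fun j : Fin n => pairingAt (AlgHom.id K (RingR K L)) b m j := by
  ext d
  rw [PowerSeries.coeff_map, coeff_neg_sum_seriesTmul, sumLogOneSub, PowerSeries.coeff_mk,
    RingHom.coe_coe, map_neg, map_sum]
  cases d with
  | zero => simp [constantCoeff_logSeries]
  | succ d =>
    simp only [logSeries, PowerSeries.coeff_mk, Algebra.TensorProduct.map_tmul, tensorRep_envH,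
      map_smul, ← TensorProduct.smul_tmul', TensorProduct.tmul_sum, map_dualPow_apply,
      tensorRep_comp_envX, ← sum_dualPow_placeSumX_tmul, Nat.add_sub_cancel, ← Finset.smul_sum,
      AlgHom.id_apply]
    rw [Finset.sum_comm]

lemma represents_seriesExp_logSeries [CharZero K] :
    Represents (seriesExp K (-∑ ν, seriesTmul (logSeries b ν) (envH K L (b ν))))
      (cocycle (AlgHom.id K (RingR K L)) b) := by
  intro m n
  have hmap := map_seriesExp (A := EnvR K L ⊗[K] EnvR K L)
    (B := (⨂[K]^m (RingR K L)) ⊗[K] (⨂[K]^n (RingR K L)))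
    (Algebra.TensorProduct.map (tensorRep K L m) (tensorRep K L n))
    (-∑ ν, seriesTmul (logSeries b ν) (envH K L (b ν)))
  rw [map_tensorRep_neg_sum_seriesTmul_logSeries] at hmap
  filter_upwards [eventually_sum_coeff_seriesExp_sumLogOneSub_of_commute (K := K)
    (Q := (⨂[K]^m (RingR K L)) ⊗[K] (⨂[K]^n (RingR K L)))
    (commute_pairingAt (AlgHom.id K (RingR K L)) b m (n := n))] with N hN
  rw [cocycle_apply, ← hN, ← hmap]
  rfl

end Logarithm

end

theorem theorem2 {K L : Type*} [Field K] [CharZero K] [NonUnitalRing L] [Module K L]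
    [IsScalarTower K L L] [SMulCommClass K L L] {ι : Type*} [Fintype ι]
    (b : Module.Basis ι K L) :
    (∃! Φ : TensorBialgebraSq K (RingR K L), IsReshetikhinExpansion (phiOneOne b) Φ) ∧
    ∀ Φ : TensorBialgebraSq K (RingR K L), IsReshetikhinExpansion (phiOneOne b) Φ →
      ∃ Xt : ι → PowerSeries (EnvR K L),
        (∀ ν, IsSeriesInX (Xt ν) ∧ PowerSeries.constantCoeff (Xt ν) = 0) ∧
        MemCompletedTensor (seriesExp K (-∑ ν, seriesTmul (Xt ν) (envH K L (b ν)))) ∧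
        Represents (seriesExp K (-∑ ν, seriesTmul (Xt ν) (envH K L (b ν)))) Φ := by
  refine ⟨⟨_, isReshetikhinExpansion_cocycle_id b,
    fun Φ hΦ => hΦ.unique (isReshetikhinExpansion_cocycle_id b)⟩, fun Φ hΦ => ?_⟩
  rw [hΦ.unique (isReshetikhinExpansion_cocycle_id b)]
  have hlog : MemCompletedTensor (-∑ ν, seriesTmul (logSeries b ν) (envH K L (b ν))) :=
    memCompletedTensor_neg_sum_seriesTmul _ (isSeriesInX_logSeries b) fun ν =>
      Algebra.subset_adjoin ⟨b ν, rfl⟩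
  exact ⟨logSeries b, fun ν => ⟨isSeriesInX_logSeries b ν, constantCoeff_logSeries b ν⟩,
    hlog.seriesExp, represents_seriesExp_logSeries b⟩
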